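/- Let $G=(V,E)$ be a connected, locally finite (finite or infinite) simple graph that is chordal, i.e. every cycle of length greater than three has a chord. A \emph{clique} is an inclusion-maximal set of pairwise adjacent vertices. The \emph{clique graph} of $G$ has the cliques of $G$ as its vertices, two distinct cliques being adjacent if they intersect. A \emph{clique tree} of $G$ is a spanning tree $T$ of the clique graph such that, for every $v\in V$, the subgraph of $T$ induced by the set of cliques containing $v$ is a tree. For $a,b\in V$, an $a$-$b$-separator is a set $W\subseteq V\setminus\{a,b\}$ such that every path from $a$ to $b$ meets $W$; it is a minimal $a$-$b$-separator if it is inclusion-minimal among the $a$-$b$-separators. A non-empty set $W\subseteq V$ is a \emph{minimal separator} of $G$ if it is a minimal $a$-$b$-separator for some $a,b\in V$. The \emph{reduced clique graph} of $G$ is the spanning subgraph of the clique graph that retains exactly those edges $K_1K_2$ for which $K_1\cap K_2$ is a minimal $a$-$b$-separator for all $a\in K_1\setminus K_2$ and $b\in K_2\setminus K_1$. Then: (1) the set $\{K_1\cap K_2 : K_1K_2 \text{ an edge of } T\}$ is the same for all clique trees $T$ of $G$; (2) for every clique tree $T$ of $G$, this set equals the set of minimal separators of $G$; (3) the union of all clique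 trees of $G$ is the reduced clique graph of $G$. -/

import Mathlib

namespace SimpleGraph

universe u

variable {V : Type u}

/-- Every cycle of length greater than three has a chord: an edge of the graph joining two vertices
of the cycle that is not an edge of the cycle. -/
def IsChordal (G : SimpleGraph V) : Prop :=
  ∀ (v : V) (c : G.Walk v v), c.IsCycle → 3 < c.length →
    ∃ x ∈ c.support, ∃ y ∈ c.support, G.Adj x y ∧ s(x, y) ∉ c.edges

/-- The cliques of `G`, in the sense of inclusion-maximal complete vertex sets. -/
def MaxClique (G : SimpleGraph V) : Type u := {K : Set V // Maximal G.IsClique K}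

/-- The set of vertices of a maximal clique. -/
def MaxClique.verts {G : SimpleGraph V} (K : G.MaxClique) : Set V := K.1

/-- The clique graph: its vertices are the maximal cliques, and two distinct ones are adjacent when
they intersect. -/
def cliqueGraph (G : SimpleGraph V) : SimpleGraph G.MaxClique where
  Adj K₁ K₂ := K₁ ≠ K₂ ∧ (K₁.verts ∩ K₂.verts).Nonempty
  symm := ⟨fun K₁ K₂ h => ⟨h.1.symm, by rw [Set.inter_comm]; exact h.2⟩⟩
  loopless := ⟨fun _ h => h.1 rfl⟩

/-- The clique family of a vertex: all maximal cliques that contain it. -/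
def cliqueFamily (G : SimpleGraph V) (v : V) : Set G.MaxClique := {K | v ∈ K.verts}

/-- `T` is a clique tree of `G`: a spanning tree of the clique graph that induces a tree on the
clique family of each vertex. -/
structure IsCliqueTree (G : SimpleGraph V) (T : SimpleGraph G.MaxClique) : Prop where
  le_cliqueGraph : T ≤ G.cliqueGraph
  isTree : T.IsTree
  isTree_induce : ∀ v : V, (T.induce (G.cliqueFamily v)).IsTree

/-- `W` separates `a` from `b`: both lie outside `W`, and every walk between them meets `W`, so that
they are in different components of `G - W`. -/
def Separates (G : SimpleGraph V) (W : Set V) (a b : V) : Prop :=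
  a ∉ W ∧ b ∉ W ∧ ∀ p : G.Walk a b, ∃ w ∈ p.support, w ∈ W

/-- `W` is a minimal `a`-`b`-separator: inclusion-minimal among the sets separating `a` from `b`. -/
def IsMinimalSeparatorOf (G : SimpleGraph V) (W : Set V) (a b : V) : Prop :=
  Minimal (fun U : Set V => G.Separates U a b) W

/-- `W` is a minimal (vertex) separator of `G`: it is non-empty and a minimal `a`-`b`-separator for
some pair of vertices `a`, `b`. -/
def IsMinimalSeparator (G : SimpleGraph V) (W : Set V) : Prop :=
  W.Nonempty ∧ ∃ a b : V, G.IsMinimalSeparatorOf W a b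

theorem Separates.symm {G : SimpleGraph V} {W : Set V} {a b : V} (h : G.Separates W a b) :
    G.Separates W b a :=
  ⟨h.2.1, h.1, fun p => by
    obtain ⟨w, hw, hW⟩ := h.2.2 p.reverse
    exact ⟨w, by simpa using hw, hW⟩⟩

theorem IsMinimalSeparatorOf.symm {G : SimpleGraph V} {W : Set V} {a b : V}
    (h : G.IsMinimalSeparatorOf W a b) : G.IsMinimalSeparatorOf W b a :=
  ⟨Separates.symm h.1, fun _ hU hUW => h.2 (Separates.symm hU) hUW⟩

/-- The reduced clique graph: the subgraph of the clique graph that retains the edges `K₁ K₂` for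
which `K₁ ∩ K₂` is a minimal separator of the two cliques, that is, a minimal `a`-`b`-separator for
all `a ∈ K₁ \ K₂` and `b ∈ K₂ \ K₁`. -/
def reducedCliqueGraph (G : SimpleGraph V) : SimpleGraph G.MaxClique where
  Adj K₁ K₂ := G.cliqueGraph.Adj K₁ K₂ ∧
    ∀ a ∈ K₁.verts \ K₂.verts, ∀ b ∈ K₂.verts \ K₁.verts,
      G.IsMinimalSeparatorOf (K₁.verts ∩ K₂.verts) a b
  symm := ⟨fun K₁ K₂ h => ⟨h.1.symm, fun a ha b hb => by
    rw [Set.inter_comm]; exact (h.2 b hb a ha).symm⟩⟩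
  loopless := ⟨fun K h => G.cliqueGraph.loopless.irrefl K h.1⟩

/-- The set of intersections `K₁ ∩ K₂` over the edges `K₁ K₂` of a graph `T` on the cliques. -/
def edgeIntersections (G : SimpleGraph V) (T : SimpleGraph G.MaxClique) : Set (Set V) :=
  {S | ∃ K₁ K₂ : G.MaxClique, T.Adj K₁ K₂ ∧ S = K₁.verts ∩ K₂.verts}

end SimpleGraph

namespace SimpleGraph

universe u

variable {V : Type u} {G : SimpleGraph V}

namespace MaxClique

/-! Deleting an edge `K L` of a clique tree `T` disconnects it, and the cliques containing a vertex
outside `K ∩ L` all stay on one side. So `K ∩ L` separates `K \ L` from `L \ K`, minimally because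
each of its vertices is adjacent to both sides. Conversely, if `S` is a minimal `a`-`b`-separator,
the path in `T` from a clique of `a` to a clique of `b` has an edge with intersection inside `S`, as
otherwise it would link `a` to `b` outside `S`; that intersection already separates, so it equals
`S`. This gives (2), hence (1), and one inclusion of (3): `IsCliqueTree.isMinimalSeparatorOf`,
`IsCliqueTree.edgeIntersections_eq`.

For the other inclusion, a Kruskal-type construction prefers larger intersections and breaks ties by
a well-ordered rank. Local finiteness makes every clique family connected
(`greedyCliqueTree_within_reachable`); chordality, through `IsChordal.meetingBeyond_reachable`,
excludes cycles. If `K L` has the lowest rank, it is rejected only when cliques meeting outside `K ∩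
L` already link `K` to `L`, which is impossible for an edge of the reduced clique graph. -/

theorem ext {K L : G.MaxClique} (h : K.verts = L.verts) : K = L := Subtype.ext h

theorem adj {K : G.MaxClique} {a b : V} (ha : a ∈ K.verts) (hb : b ∈ K.verts) (h : a ≠ b) :
    G.Adj a b := K.2.1 ha hb h

theorem eq_of_subset {K L : G.MaxClique} (h : K.verts ⊆ L.verts) : K = L :=
  ext (h.antisymm (K.2.2 L.2.1 h))

theorem exists_mem_diff {K L : G.MaxClique} (h : K ≠ L) : ∃ a, a ∈ K.verts \ L.verts := by
  by_contra! hc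
  exact h (eq_of_subset fun a ha => by_contra fun hL => hc a ⟨ha, hL⟩)

end MaxClique

theorem IsClique.exists_maxClique {s : Set V} (hs : G.IsClique s) :
    ∃ K : G.MaxClique, s ⊆ K.verts := by
  obtain ⟨m, hm, hmax⟩ := zorn_subset_nonempty {t | G.IsClique t} (fun c hc hch _ =>
    ⟨⋃₀ c, by
      rintro a ⟨s, hs, ha⟩ b ⟨t, ht, hb⟩ hab
      rcases hch.total hs ht with h | h
      · exact hc ht (h ha) hb hab
      · exact hc hs ha (h hb) hab, fun s hs => Set.subset_sUnion_of_mem hs⟩) s hs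
  exact ⟨⟨m, hmax⟩, hm⟩

theorem exists_maxClique_mem (v : V) : ∃ K : G.MaxClique, v ∈ K.verts := by
  obtain ⟨K, hK⟩ := (isClique_singleton (G := G) v).exists_maxClique
  exact ⟨K, hK rfl⟩

theorem Adj.exists_maxClique {a b : V} (h : G.Adj a b) :
    ∃ K : G.MaxClique, a ∈ K.verts ∧ b ∈ K.verts := by
  obtain ⟨K, hK⟩ := (isClique_pair.2 fun _ => h : G.IsClique {a, b}).exists_maxClique
  exact ⟨K, hK (by simp), hK (by simp)⟩

/-- No maximal clique lies in the intersection of two different ones. -/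
theorem exists_mem_notMem_inter {K L : G.MaxClique} (h : K ≠ L) (M : G.MaxClique) :
    ∃ a ∈ M.verts, a ∉ K.verts ∩ L.verts := by
  by_contra! hc
  have h1 : M = K := MaxClique.eq_of_subset fun a ha => (hc a ha).1
  have h2 : M = L := MaxClique.eq_of_subset fun a ha => (hc a ha).2
  exact h (h1.symm.trans h2)

/-! ### Separation in terms of vertices and of cliques -/

/-- The spanning subgraph of `G` without the edges that meet `S`. -/
def avoiding (G : SimpleGraph V) (S : Set V) : SimpleGraph V where
  Adj x y := G.Adj x y ∧ x ∉ S ∧ y ∉ S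
  symm := ⟨fun _ _ h => ⟨h.1.symm, h.2.2, h.2.1⟩⟩
  loopless := ⟨fun _ h => G.loopless.irrefl _ h.1⟩

theorem avoiding_le (S : Set V) : G.avoiding S ≤ G := fun _ _ h => h.1

theorem avoiding_support {S : Set V} {x y : V} (p : (G.avoiding S).Walk x y) (hx : x ∉ S) :
    ∀ z ∈ p.support, z ∉ S := by
  induction p with
  | nil => simpa using hx
  | cons h p ih =>
    intro z hz
    rw [Walk.support_cons, List.mem_cons] at hz
    rcases hz with rfl | hz
    · exact hx
    · exact ih h.2.2 z hz

theorem separates_iff {S : Set V} {a b : V} :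
    G.Separates S a b ↔ a ∉ S ∧ b ∉ S ∧ ¬ (G.avoiding S).Reachable a b := by
  refine and_congr_right fun ha => and_congr_right fun _ => ⟨fun h ⟨p⟩ => ?_, fun h p => ?_⟩
  · obtain ⟨w, hw, hwS⟩ := h (p.mapLe (avoiding_le S))
    exact avoiding_support p ha w (by simpa using hw) hwS
  · by_contra! hc
    refine h ⟨p.transfer _ fun e he => ?_⟩
    induction e with | h x y =>
    exact ⟨p.adj_of_mem_edges he, hc _ (p.fst_mem_support_of_mem_edges he),
      hc _ (p.snd_mem_support_of_mem_edges he)⟩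

/-- The graph on the maximal cliques that joins those that meet outside `S`. -/
def meetingOutside (G : SimpleGraph V) (S : Set V) : SimpleGraph G.MaxClique where
  Adj K L := K ≠ L ∧ ∃ x, x ∈ K.verts ∧ x ∈ L.verts ∧ x ∉ S
  symm := ⟨fun _ _ h => ⟨h.1.symm, h.2.imp fun _ hx => ⟨hx.2.1, hx.1, hx.2.2⟩⟩⟩
  loopless := ⟨fun _ h => h.1 rfl⟩

theorem MaxClique.avoiding_reachable {S : Set V} {K : G.MaxClique} {x y : V} (hx : x ∈ K.verts)
    (hy : y ∈ K.verts) (hxS : x ∉ S) (hyS : y ∉ S) : (G.avoiding S).Reachable x y := by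
  by_cases h : x = y
  · rw [h]
  · exact Adj.reachable ⟨K.adj hx hy h, hxS, hyS⟩

theorem meetingOutside_reachable {S : Set V} {K L : G.MaxClique}
    (h : (G.meetingOutside S).Reachable K L) {x y : V} (hx : x ∈ K.verts) (hxS : x ∉ S)
    (hy : y ∈ L.verts) (hyS : y ∉ S) : (G.avoiding S).Reachable x y := by
  obtain ⟨p⟩ := h
  induction p generalizing x with
  | nil => exact MaxClique.avoiding_reachable hx hy hxS hyS
  | cons h p ih =>
    obtain ⟨_, z, hz, hz', hzS⟩ := h
    exact (MaxClique.avoiding_reachable hx hz hxS hzS).trans (ih hz' hzS hy)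

/-! ### Edges of a clique tree -/

/-- The subtree on the clique family of `v` does not use the edge `K L`, since `v` misses `K` or
`L`. -/
theorem IsCliqueTree.reachable_of_mem {T : SimpleGraph G.MaxClique} (hT : G.IsCliqueTree T)
    {K L : G.MaxClique} {v : V} (hv : v ∉ K.verts ∩ L.verts) {A B : G.MaxClique}
    (hA : v ∈ A.verts) (hB : v ∈ B.verts) : (T.deleteEdges {s(K, L)}).Reachable A B := by
  have h := (hT.isTree_induce v).connected.preconnected ⟨A, hA⟩ ⟨B, hB⟩
  refine h.map (G' := T.deleteEdges {s(K, L)}) ⟨Subtype.val, ?_⟩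
  rintro ⟨C, hC⟩ ⟨D, hD⟩ hCD
  rw [deleteEdges_adj]
  refine ⟨hCD, fun he => hv ?_⟩
  rcases Sym2.eq_iff.1 he with ⟨rfl, rfl⟩ | ⟨rfl, rfl⟩
  · exact ⟨hC, hD⟩
  · exact ⟨hD, hC⟩

theorem IsCliqueTree.reachable_of_avoiding {T : SimpleGraph G.MaxClique} (hT : G.IsCliqueTree T)
    {K L : G.MaxClique} {a b : V} (h : (G.avoiding (K.verts ∩ L.verts)).Reachable a b)
    (hb : b ∉ K.verts ∩ L.verts) {A B : G.MaxClique}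
    (hA : a ∈ A.verts) (hB : b ∈ B.verts) : (T.deleteEdges {s(K, L)}).Reachable A B := by
  obtain ⟨p⟩ := h
  induction p generalizing A with
  | nil => exact hT.reachable_of_mem hb hA hB
  | cons h p ih =>
    obtain ⟨C, hC, hC'⟩ := h.1.exists_maxClique
    exact (hT.reachable_of_mem h.2.1 hA hC).trans (ih hb hC' hB)

theorem IsCliqueTree.isMinimalSeparatorOf {T : SimpleGraph G.MaxClique} (hT : G.IsCliqueTree T)
    {K L : G.MaxClique} (h : T.Adj K L) {a b : V} (ha : a ∈ K.verts \ L.verts)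
    (hb : b ∈ L.verts \ K.verts) : G.IsMinimalSeparatorOf (K.verts ∩ L.verts) a b := by
  have hbr := isBridge_iff.1 (isAcyclic_iff_forall_adj_isBridge.1 hT.isTree.isAcyclic h)
  refine ⟨separates_iff.2 ⟨fun h => ha.2 h.2, fun h => hb.2 h.1, fun hr => hbr ?_⟩, ?_⟩
  · exact hT.reachable_of_avoiding hr (fun h => hb.2 h.1) ha.1 hb.1
  -- Each `s` in the intersection gives the walk `a, s, b`, which a separator can only meet in `s`.
  · rintro U ⟨haU, hbU, hU⟩ - s ⟨hsK, hsL⟩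
    have has : G.Adj a s := K.adj ha.1 hsK fun e => ha.2 (e ▸ hsL)
    have hsb : G.Adj s b := L.adj hsL hb.1 fun e => hb.2 (e ▸ hsK)
    obtain ⟨w, hw, hwU⟩ := hU (.cons has (.cons hsb .nil))
    simp only [Walk.support_cons, Walk.support_nil, List.mem_cons, List.not_mem_nil,
      or_false] at hw
    rcases hw with rfl | rfl | rfl
    · exact absurd hwU haU
    · exact hwU
    · exact absurd hwU hbU

theorem IsCliqueTree.le_reducedCliqueGraph {T : SimpleGraph G.MaxClique}
    (hT : G.IsCliqueTree T) : T ≤ G.reducedCliqueGraph := fun _ _ h =>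
  ⟨hT.le_cliqueGraph h, fun _ ha _ hb => hT.isMinimalSeparatorOf h ha hb⟩

theorem IsAcyclic.not_reachable_deleteEdges {W : Type*} {T : SimpleGraph W} (hT : T.IsAcyclic)
    {A B : W} {p : T.Walk A B} (hp : p.IsPath) {e : Sym2 W} (he : e ∈ p.edges) :
    ¬ (T.deleteEdges {e}).Reachable A B := by
  classical
  rintro ⟨q⟩
  have h := congrArg Subtype.val
    ((hT.subsingleton_path A B).elim ⟨p, hp⟩ (q.mapLe (deleteEdges_le {e})).toPath)
  rw [show p = _ from h] at he
  have he' := Walk.edges_toPath_subset_edges _ he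
  rw [Walk.edges_mapLe_eq_edges] at he'
  have := q.edges_subset_edgeSet he'
  simp [edgeSet_deleteEdges] at this

theorem IsCliqueTree.edgeIntersections_eq {T : SimpleGraph G.MaxClique} (hT : G.IsCliqueTree T) :
    G.edgeIntersections T = {S : Set V | G.IsMinimalSeparator S} := by
  ext S
  constructor
  · rintro ⟨K, L, h, rfl⟩
    obtain ⟨a, ha⟩ := MaxClique.exists_mem_diff h.ne
    obtain ⟨b, hb⟩ := MaxClique.exists_mem_diff h.ne.symm
    exact ⟨(hT.le_cliqueGraph h).2, a, b, hT.isMinimalSeparatorOf h ha hb⟩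
  · rintro ⟨-, a, b, hS⟩
    obtain ⟨ha, hb, hab⟩ := separates_iff.1 hS.1
    obtain ⟨A, hA⟩ := G.exists_maxClique_mem a
    obtain ⟨B, hB⟩ := G.exists_maxClique_mem b
    obtain ⟨p, hp⟩ := (hT.isTree.connected.preconnected A B).exists_isPath
    by_cases hsub : ∃ K L, s(K, L) ∈ p.edges ∧ K.verts ∩ L.verts ⊆ S
    · obtain ⟨K, L, he, hKL⟩ := hsub
      refine ⟨K, L, p.adj_of_mem_edges he, (hKL.antisymm (hS.2 ?_ hKL)).symm⟩
      refine separates_iff.2 ⟨fun h => ha (hKL h), fun h => hb (hKL h), fun hr => ?_⟩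
      exact hT.isTree.isAcyclic.not_reachable_deleteEdges hp he
        (hT.reachable_of_avoiding hr (fun h => hb (hKL h)) hA hB)
    · push Not at hsub
      refine absurd (meetingOutside_reachable ⟨p.transfer (G.meetingOutside S) ?_⟩ hA ha hB hb) hab
      intro e he
      induction e with | h K L =>
      obtain ⟨x, hx, hxS⟩ := Set.not_subset.1 (hsub K L he)
      exact ⟨(p.adj_of_mem_edges he).ne, x, hx.1, hx.2, hxS⟩

/-! ### Shortest paths outside a complete set in a chordal graph -/

/-- Between two neighbours of `s` on opposite ends of a shortest path of length at least two that
avoids `s`, there is a further neighbour of `s`. -/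
theorem IsChordal.exists_adj_interior (hG : G.IsChordal) {S : Set V} {s x y : V} (hs : s ∈ S)
    (hxS : x ∉ S) (p : (G.avoiding S).Walk x y)
    (hmin : ∀ q : (G.avoiding S).Walk x y, p.length ≤ q.length) (hlen : 2 ≤ p.length)
    (hsx : G.Adj s x) (hsy : G.Adj s y) : ∃ w ∈ p.support, w ≠ x ∧ w ≠ y ∧ G.Adj s w := by
  classical
  have hp : p.IsPath := by
    refine p.isPath_of_length_eq_dist ?_
    obtain ⟨q, hq⟩ := p.reachable.exists_walk_length_eq_dist
    exact le_antisymm (hq ▸ hmin q) (dist_le p)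
  have hpS := avoiding_support p hxS
  have hxy : x ≠ y := by
    rintro rfl
    have := hmin .nil
    simp only [Walk.length_nil] at this
    omega
  -- A shortest walk admits no shortcut, so its adjacent vertices are consecutive.
  have hshort : ∀ i j, i < j → j ≤ p.length → G.Adj (p.getVert i) (p.getVert j) → j = i + 1 := by
    intro i j hij hj hadj
    have hadj' : (G.avoiding S).Adj (p.getVert i) (p.getVert j) :=
      ⟨hadj, hpS _ (p.getVert_mem_support i), hpS _ (p.getVert_mem_support j)⟩
    have h := hmin ((p.take i).append (Walk.cons hadj' (p.drop j)))
    simp only [Walk.length_append, Walk.length_cons, Walk.take_length, Walk.drop_length] at h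
    omega
  have hchord : ∀ i j, i < j → j ≤ p.length → G.Adj (p.getVert i) (p.getVert j) →
      s(p.getVert i, p.getVert j) ∈ p.edges := by
    intro i j hij hj hadj
    obtain rfl := hshort i j hij hj hadj
    exact p.adj_toSubgraph_iff_mem_edges.1 (p.toSubgraph_adj_getVert (by omega))
  let p' : G.Walk x y := p.mapLe (avoiding_le S)
  have hsp : s ∉ p'.support := by
    intro h
    exact hpS s (by simpa [p'] using h) hs
  have hp'edges : p'.edges = p.edges := Walk.edges_mapLe_eq_edges ..
  have hp'supp : p'.support = p.support := Walk.support_mapLe_eq_support ..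
  let c : G.Walk s s := .cons hsx (p'.concat hsy.symm)
  have hc : c.IsCycle := by
    refine (Walk.cons_isCycle_iff _ _).2 ⟨Walk.IsPath.concat (hp.mapLe _) hsp _, ?_⟩
    rw [Walk.edges_concat, List.concat_eq_append, List.mem_append, List.mem_singleton]
    rintro (h | h)
    · exact hsp (p'.fst_mem_support_of_mem_edges h)
    · rcases Sym2.eq_iff.1 h with ⟨rfl, _⟩ | ⟨_, h⟩
      · exact hsy.ne rfl
      · exact hxy h
  obtain ⟨u, hu, w, hw, huw, hne⟩ := hG s c hc (by simp [c, p']; omega)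
  have hsupp : ∀ z, z ∈ c.support → z = s ∨ z ∈ p.support := by
    intro z hz
    simp only [c, Walk.support_cons, Walk.support_concat, List.mem_cons, List.mem_append,
      hp'supp] at hz
    simpa [or_comm, or_assoc] using hz
  have hedge : ∀ e, e ∉ c.edges → e ≠ s(s, x) ∧ e ∉ p.edges ∧ e ≠ s(y, s) := by
    intro e he
    simp only [c, Walk.edges_cons, Walk.edges_concat, List.mem_cons, List.concat_eq_append,
      List.mem_append, hp'edges, not_or] at he
    exact ⟨he.1, he.2.1, he.2.2.1⟩
  have hspoke : ∀ z, z ∈ c.support → G.Adj s z → s(s, z) ∉ c.edges →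
      ∃ w ∈ p.support, w ≠ x ∧ w ≠ y ∧ G.Adj s w := by
    intro z hz hsz hze
    obtain ⟨h1, -, h3⟩ := hedge _ hze
    refine ⟨z, (hsupp z hz).resolve_left hsz.ne', ?_, ?_, hsz⟩
    · rintro rfl; exact h1 rfl
    · rintro rfl; exact h3 Sym2.eq_swap
  -- The chord must end in `s`: a chord between two vertices of the path would be an edge of the
  -- path.
  rcases hsupp u hu with rfl | hu'
  · exact hspoke w hw huw hne
  rcases hsupp w hw with rfl | hw'
  · exact hspoke u hu huw.symm (by rwa [Sym2.eq_swap])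
  exfalso
  obtain ⟨i, rfl, hi⟩ := Walk.mem_support_iff_exists_getVert.1 hu'
  obtain ⟨j, rfl, hj⟩ := Walk.mem_support_iff_exists_getVert.1 hw'
  rcases lt_trichotomy i j with h | rfl | h
  · exact (hedge _ hne).2.1 (hchord i j h hj huw)
  · exact huw.ne rfl
  · exact (hedge _ hne).2.1 (Sym2.eq_swap ▸ hchord j i h hi huw.symm)

/-- An interior neighbour of `s` splits a shortest walk into two strictly shorter shortest walks
whose ends are again neighbours of `s`. -/
theorem IsChordal.adj_of_mem_support (hG : G.IsChordal) {S : Set V} {s : V} (hs : s ∈ S) :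
    ∀ (n : ℕ) {x y : V} (p : (G.avoiding S).Walk x y), p.length = n → x ∉ S →
      (∀ q : (G.avoiding S).Walk x y, p.length ≤ q.length) →
      G.Adj s x → G.Adj s y → ∀ w ∈ p.support, G.Adj s w := by
  classical
  intro n
  induction n using Nat.strong_induction_on with | _ n ih =>
  intro x y p hn hxS hmin hsx hsy w hw
  by_cases hlen : 2 ≤ p.length
  · obtain ⟨z, hz, hzx, hzy, hsz⟩ := hG.exists_adj_interior hs hxS p hmin hlen hsx hsy
    have hsum : (p.takeUntil z hz).length + (p.dropUntil z hz).length = p.length := by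
      rw [← Walk.length_append, Walk.take_spec]
    have h1 : 0 < (p.takeUntil z hz).length :=
      Nat.pos_of_ne_zero fun h => hzx (Walk.eq_of_length_eq_zero h).symm
    have h2 : 0 < (p.dropUntil z hz).length :=
      Nat.pos_of_ne_zero fun h => hzy (Walk.eq_of_length_eq_zero h)
    rw [← Walk.take_spec p hz, Walk.mem_support_append_iff] at hw
    rcases hw with hw | hw
    · refine ih _ (by omega) (p.takeUntil z hz) rfl hxS (fun q => ?_) hsx hsz w hw
      have := hmin (q.append (p.dropUntil z hz))
      rw [Walk.length_append] at this
      omega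
    · refine ih _ (by omega) (p.dropUntil z hz) rfl (avoiding_support p hxS z hz)
        (fun q => ?_) hsz hsy w hw
      have := hmin ((p.takeUntil z hz).append q)
      rw [Walk.length_append] at this
      omega
  · obtain ⟨i, rfl, hi⟩ := Walk.mem_support_iff_exists_getVert.1 hw
    rcases Nat.eq_zero_or_pos i with rfl | h0
    · simpa using hsx
    · obtain rfl : i = p.length := by omega
      simpa using hsy

/-! ### Linking cliques through cliques that contain `S` -/

/-- The graph on the maximal cliques that joins those whose intersection properly contains `S`. -/
def meetingBeyond (G : SimpleGraph V) (S : Set V) : SimpleGraph G.MaxClique where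
  Adj K L := K ≠ L ∧ S ⊂ K.verts ∩ L.verts
  symm := ⟨fun K L h => ⟨h.1.symm, by rw [Set.inter_comm]; exact h.2⟩⟩
  loopless := ⟨fun _ h => h.1 rfl⟩

theorem meetingBeyond_reachable_of_mem {S : Set V} {K L : G.MaxClique} (hK : S ⊆ K.verts)
    (hL : S ⊆ L.verts) {x : V} (hxK : x ∈ K.verts) (hxL : x ∈ L.verts) (hxS : x ∉ S) :
    (G.meetingBeyond S).Reachable K L := by
  by_cases h : K = L
  · rw [h]
  · exact Adj.reachable ⟨h, (Set.subset_inter hK hL).ssubset_of_mem_notMem ⟨hxK, hxL⟩ hxS⟩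

/-- Each edge of the walk together with `S` is complete and extends to a maximal clique; consecutive
ones share a vertex of the walk. -/
theorem meetingBeyond_reachable_of_walk {S : Set V} (hS : G.IsClique S) {x y : V}
    (p : (G.avoiding S).Walk x y) (hp : ∀ w ∈ p.support, ∀ s ∈ S, G.Adj s w) (hxS : x ∉ S)
    {K L : G.MaxClique} (hK : S ⊆ K.verts) (hL : S ⊆ L.verts) (hxK : x ∈ K.verts)
    (hyL : y ∈ L.verts) : (G.meetingBeyond S).Reachable K L := by
  induction p generalizing K with
  | nil => exact meetingBeyond_reachable_of_mem hK hL hxK hyL hxS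
  | @cons x z y h p ih =>
    have hzS := h.2.2
    have hcl : G.IsClique (insert x (insert z S)) := by
      rw [isClique_insert, isClique_insert]
      refine ⟨⟨hS, fun s hs _ => (hp z (by simp) s hs).symm⟩, ?_⟩
      rintro s (rfl | hs) _
      · exact h.1
      · exact (hp x (by simp) s hs).symm
    obtain ⟨M, hM⟩ := hcl.exists_maxClique
    have hSM : S ⊆ M.verts := fun s hs => hM (by simp [hs])
    exact (meetingBeyond_reachable_of_mem hK hSM hxK (hM (by simp)) hxS).trans
      (ih (fun w hw => hp w (by simp [hw])) hzS hSM (hM (by simp)) hyL)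

/-- Maximal cliques that contain a complete set `S` properly and are connected outside `S` are
connected through maximal cliques that contain `S`, any two consecutive ones of which share a
vertex outside `S`. -/
theorem IsChordal.meetingBeyond_reachable (hG : G.IsChordal) {S : Set V} {K L : G.MaxClique}
    (hK : S ⊆ K.verts) (hL : S ⊆ L.verts) (hKS : ∃ x ∈ K.verts, x ∉ S)
    (hLS : ∃ x ∈ L.verts, x ∉ S) (h : (G.meetingOutside S).Reachable K L) :
    (G.meetingBeyond S).Reachable K L := by
  obtain ⟨x, hx, hxS⟩ := hKS
  obtain ⟨y, hy, hyS⟩ := hLS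
  have hr := meetingOutside_reachable h hx hxS hy hyS
  obtain ⟨p, hp⟩ := hr.exists_walk_length_eq_dist
  refine meetingBeyond_reachable_of_walk (K.2.1.subset hK) p (fun w hw s hs => ?_) hxS hK hL hx hy
  exact hG.adj_of_mem_support hs _ p rfl hxS (fun q => hp ▸ dist_le q)
    (K.adj (hK hs) hx fun e => hxS (e ▸ hs)) (L.adj (hL hs) hy fun e => hyS (e ▸ hs)) w hw

/-! ### The greedy clique tree -/

theorem Reachable.of_forall_adj {W : Type*} {H H' : SimpleGraph W}
    (hH : ∀ A B, H.Adj A B → H'.Reachable A B) {A B : W} (h : H.Reachable A B) :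
    H'.Reachable A B := by
  obtain ⟨p⟩ := h
  induction p with
  | nil => exact Reachable.refl _
  | cons h p ih => exact (hH _ _ h).trans ih

variable {ι : Type*} [LinearOrder ι]

/-- The graph on the maximal cliques of those pairs whose intersection contains `S` properly, or
equals `S` with the pair ranked below `r`. -/
def preceding (rank : Sym2 G.MaxClique → ι) (S : Set V) (r : ι) : SimpleGraph G.MaxClique where
  Adj K L := K ≠ L ∧ S ⊆ K.verts ∩ L.verts ∧ (K.verts ∩ L.verts ≠ S ∨ rank s(K, L) < r)
  symm := ⟨fun K L h => ⟨h.1.symm, by rw [Set.inter_comm, Sym2.eq_swap]; exact h.2⟩⟩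
  loopless := ⟨fun _ h => h.1 rfl⟩

/-- The greedy spanning tree of the clique graph, where pairs with larger intersections precede
those with smaller ones and `rank` breaks ties: a pair is kept unless its cliques are already
connected by preceding ones. -/
def greedyCliqueTree (rank : Sym2 G.MaxClique → ι) : SimpleGraph G.MaxClique where
  Adj K L := G.cliqueGraph.Adj K L ∧
    ¬ (preceding rank (K.verts ∩ L.verts) (rank s(K, L))).Reachable K L
  symm := ⟨fun K L h => ⟨h.1.symm, by
    rw [Set.inter_comm, Sym2.eq_swap, reachable_comm]; exact h.2⟩⟩
  loopless := ⟨fun K h => G.cliqueGraph.loopless.irrefl K h.1⟩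

/-- The restriction of a graph on the maximal cliques to those that contain `S`. -/
def within (T : SimpleGraph G.MaxClique) (S : Set V) : SimpleGraph G.MaxClique where
  Adj K L := T.Adj K L ∧ S ⊆ K.verts ∧ S ⊆ L.verts
  symm := ⟨fun _ _ h => ⟨h.1.symm, h.2.2, h.2.1⟩⟩
  loopless := ⟨fun K h => T.loopless.irrefl K h.1⟩

theorem within_anti (T : SimpleGraph G.MaxClique) {S S' : Set V} (h : S ⊆ S') :
    within T S' ≤ within T S := fun _ _ hKL => ⟨hKL.1, h.trans hKL.2.1, h.trans hKL.2.2⟩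

/-- A rejected pair is linked by preceding pairs, to which induction applies: either the
intersection grows, which is well-founded because it stays in the finite closed neighbourhood of
`v`, or it is unchanged and the rank drops. -/
theorem greedyCliqueTree_within_reachable [WellFoundedLT ι]
    (hfin : ∀ v : V, (G.neighborSet v).Finite) (rank : Sym2 G.MaxClique → ι) {v : V} :
    ∀ {K L : G.MaxClique}, K ≠ L → v ∈ K.verts ∩ L.verts →
      (within (greedyCliqueTree rank) (K.verts ∩ L.verts)).Reachable K L := by
  have hX : (insert v (G.neighborSet v)).Finite := (hfin v).insert v
  set X := insert v (G.neighborSet v)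
  have hsub : ∀ K : G.MaxClique, v ∈ K.verts → K.verts ⊆ X := fun K hK a ha => by
    by_cases h : a = v
    · exact Or.inl h
    · exact Or.inr (K.adj hK ha (Ne.symm h))
  suffices ∀ (n : ℕ) (r : ι) (K L : G.MaxClique), (X \ (K.verts ∩ L.verts)).ncard = n →
      rank s(K, L) = r → K ≠ L → v ∈ K.verts ∩ L.verts →
      (within (greedyCliqueTree rank) (K.verts ∩ L.verts)).Reachable K L from
    fun {K L} => this _ _ K L rfl rfl
  intro n
  induction n using Nat.strong_induction_on with | _ n ihn =>
  intro r
  induction r using WellFoundedLT.induction with | _ r ihr =>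
  intro K L hn hr hne hv
  by_cases hadj : (greedyCliqueTree rank).Adj K L
  · exact Adj.reachable ⟨hadj, Set.inter_subset_left, Set.inter_subset_right⟩
  have hprec : (preceding rank (K.verts ∩ L.verts) (rank s(K, L))).Reachable K L := by
    by_contra h
    exact hadj ⟨⟨hne, v, hv⟩, h⟩
  refine hprec.of_forall_adj fun A B hAB => ?_
  obtain ⟨hne', hsubS, hor⟩ := hAB
  have hv' := hsubS hv
  by_cases heq : A.verts ∩ B.verts = K.verts ∩ L.verts
  · rw [← heq]
    exact ihr _ (hr ▸ hor.resolve_left (not_not.2 heq)) A B (heq ▸ hn) rfl hne' hv'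
  · refine (ihn _ ?_ _ A B rfl rfl hne' hv').mono (within_anti _ hsubS)
    rw [← hn]
    obtain ⟨a, ha, haS⟩ := Set.not_subset.1 fun h => heq (h.antisymm hsubS)
    exact Set.ncard_lt_ncard ((Set.sdiff_subset_sdiff_right hsubS).ssubset_of_mem_notMem
      ⟨hsub A hv'.1 ha.1, haS⟩ fun h => h.2 ha) hX.sdiff

theorem reachable_induce_cliqueFamily {T : SimpleGraph G.MaxClique} {v : V} {K L : G.MaxClique}
    (h : (within T {v}).Reachable K L) (hK : v ∈ K.verts) (hL : v ∈ L.verts) :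
    (T.induce (G.cliqueFamily v)).Reachable ⟨K, hK⟩ ⟨L, hL⟩ := by
  obtain ⟨p⟩ := h
  induction p with
  | nil => exact Reachable.refl _
  | @cons A B C h p ih =>
    have hB : v ∈ B.verts := h.2.2 rfl
    exact (Adj.reachable (G := T.induce (G.cliqueFamily v)) (u := ⟨A, hK⟩) (v := ⟨B, hB⟩)
      h.1).trans (ih hB hL)

theorem greedyCliqueTree_induce_preconnected [WellFoundedLT ι]
    (hfin : ∀ v : V, (G.neighborSet v).Finite) (rank : Sym2 G.MaxClique → ι) (v : V) :
    ((greedyCliqueTree rank).induce (G.cliqueFamily v)).Preconnected := by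
  rintro ⟨K, hK⟩ ⟨L, hL⟩
  by_cases h : K = L
  · subst h; exact Reachable.refl _
  · have hv : v ∈ K.verts ∩ L.verts := ⟨hK, hL⟩
    exact reachable_induce_cliqueFamily ((greedyCliqueTree_within_reachable hfin rank h hv).mono
      (within_anti _ (Set.singleton_subset_iff.2 hv))) hK hL

/-- The ends of an edge of `G` lie in a common clique, so clique families overlap along a walk. -/
theorem Connected.of_forall_induce_preconnected (hconn : G.Connected)
    {T : SimpleGraph G.MaxClique}
    (hT : ∀ v, (T.induce (G.cliqueFamily v)).Preconnected) : T.Connected := by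
  have hv : ∀ {v : V} {K L : G.MaxClique}, v ∈ K.verts → v ∈ L.verts → T.Reachable K L :=
    fun {v K L} hK hL => (hT v ⟨K, hK⟩ ⟨L, hL⟩).map (Embedding.induce _).toHom
  have hmem : ∀ K : G.MaxClique, ∃ a, a ∈ K.verts := by
    intro K
    by_contra! hc
    obtain ⟨M, hM⟩ := G.exists_maxClique_mem hconn.nonempty.some
    have := MaxClique.eq_of_subset (K := K) (L := M) fun a ha => absurd ha (hc a)
    exact hc _ (this ▸ hM)
  have : Nonempty G.MaxClique := ⟨(G.exists_maxClique_mem hconn.nonempty.some).choose⟩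
  refine ⟨fun K L => ?_⟩
  obtain ⟨a, ha⟩ := hmem K
  obtain ⟨b, hb⟩ := hmem L
  obtain ⟨p⟩ := hconn.preconnected a b
  induction p generalizing K with
  | nil => exact hv ha hb
  | cons h p ih =>
    obtain ⟨M, hM, hM'⟩ := h.exists_maxClique
    exact (hv ha hM).trans (ih M hM' hb)

/-- The intersection of the two cliques of an unordered pair. -/
def inter (e : Sym2 G.MaxClique) : Set V :=
  Sym2.lift ⟨fun K L => K.verts ∩ L.verts, fun _ _ => Set.inter_comm _ _⟩ e

@[simp] theorem inter_mk (K L : G.MaxClique) : inter s(K, L) = K.verts ∩ L.verts := rfl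

theorem MaxClique.finite (hfin : ∀ v : V, (G.neighborSet v).Finite) (K : G.MaxClique) :
    K.verts.Finite := by
  rcases K.verts.eq_empty_or_nonempty with h | ⟨v, hv⟩
  · rw [h]; exact Set.finite_empty
  · refine ((hfin v).insert v).subset fun a ha => ?_
    by_cases h : a = v
    · exact Or.inl h
    · exact Or.inr (K.adj hv ha (Ne.symm h))

/-! ### Acyclicity of the greedy tree and prescribed edges -/

theorem IsChordal.greedyCliqueTree_isAcyclic (hG : G.IsChordal)
    (hfin : ∀ v : V, (G.neighborSet v).Finite) {rank : Sym2 G.MaxClique → ι}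
    (hrank : Function.Injective rank) : (greedyCliqueTree rank).IsAcyclic := by
  classical
  intro u c hc
  -- The last edge of the cycle in the greedy order: smallest intersection, then highest rank, hence
  -- the dual order.
  obtain ⟨e, he, hmin⟩ := c.edges.toFinset.exists_min_image
    (fun e => toLex ((inter e).ncard, OrderDual.toDual (rank e)))
    (by rw [List.toFinset_nonempty_iff]; simp [hc.not_nil])
  rw [List.mem_toFinset] at he
  induction e with | h K L =>
  set S := K.verts ∩ L.verts with hS
  have hKL := c.adj_of_mem_edges he
  -- every other pair on the cycle precedes `K`, `L` or meets outside `S`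
  have hother : ∀ A B, s(A, B) ∈ c.edges → s(A, B) ≠ s(K, L) →
      (∃ x, x ∈ A.verts ∧ x ∈ B.verts ∧ x ∉ S) ∨
        A.verts ∩ B.verts = S ∧ rank s(A, B) < rank s(K, L) := by
    intro A B hAB hne
    by_cases hsub : A.verts ∩ B.verts ⊆ S
    · right
      have hle := hmin _ (List.mem_toFinset.2 hAB)
      rw [Prod.Lex.toLex_le_toLex] at hle
      have hSfin : S.Finite := (K.finite hfin).subset Set.inter_subset_left
      rcases hle with hlt | ⟨heq, hle⟩
      · exact absurd (Set.ncard_le_ncard hsub hSfin) (not_le.2 hlt)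
      · refine ⟨Set.eq_of_subset_of_ncard_le hsub heq.le hSfin, ?_⟩
        exact lt_of_le_of_ne hle fun h => hne (hrank h)
    · obtain ⟨x, hx, hxS⟩ := Set.not_subset.1 hsub
      exact Or.inl ⟨x, hx.1, hx.2, hxS⟩
  have hbeyond : G.meetingBeyond S ≤ preceding rank S (rank s(K, L)) := fun A B h =>
    ⟨h.1, h.2.subset, Or.inl h.2.ne'⟩
  have hjoin : ∀ {A B : G.MaxClique}, S ⊆ A.verts → S ⊆ B.verts →
      (G.meetingOutside S).Reachable A B →
      (preceding rank S (rank s(K, L))).Reachable A B := fun {A B} hA hB h =>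
    (hG.meetingBeyond_reachable hA hB (exists_mem_notMem_inter hKL.ne A)
      (exists_mem_notMem_inter hKL.ne B) h).mono hbeyond
  -- The cycle alone, so that deleting `K L` leaves a walk along the remaining edges.
  let H : SimpleGraph G.MaxClique := fromEdgeSet {e | e ∈ c.edges}
  have hcH : ∀ e ∈ c.edges, e ∈ H.edgeSet := by
    intro e he
    rw [edgeSet_fromEdgeSet]
    exact ⟨he, fun hd => (greedyCliqueTree rank).not_isDiag_of_mem_edgeSet
      (c.edges_subset_edgeSet he) hd⟩
  obtain ⟨-, ⟨p⟩⟩ := adj_and_reachable_delete_edges_iff_exists_cycle.2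
    ⟨u, c.transfer H hcH, hc.transfer hcH, by rwa [Walk.edges_transfer]⟩
  -- Cliques on the walk need not contain `S`. The invariant keeps a clique `M ⊇ S` reached by
  -- preceding pairs and linked to the current clique outside `S`; chordality (`hjoin`) turns that
  -- link into preceding pairs whenever the current clique contains `S`.
  have key : ∀ {A B : G.MaxClique} (q : (H.deleteEdges {s(K, L)}).Walk A B),
      (∃ M : G.MaxClique, S ⊆ M.verts ∧ (preceding rank S (rank s(K, L))).Reachable K M ∧
        (G.meetingOutside S).Reachable M A) → S ⊆ B.verts →
      (preceding rank S (rank s(K, L))).Reachable K B := by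
    intro A B q
    induction q with
    | nil =>
      rintro ⟨M, hM, hKM, hMA⟩ hB
      exact hKM.trans (hjoin hM hB hMA)
    | @cons A C B h q ih =>
      rintro ⟨M, hM, hKM, hMA⟩ hB
      rw [deleteEdges_adj, fromEdgeSet_adj] at h
      obtain ⟨⟨hmem, hne⟩, hne'⟩ := h
      refine ih ?_ hB
      rcases hother A C hmem hne' with hx | ⟨heq, hlt⟩
      · exact ⟨M, hM, hKM, hMA.trans (Adj.reachable ⟨hne, hx⟩)⟩
      · have hA : S ⊆ A.verts := heq ▸ Set.inter_subset_left
        have hC : S ⊆ C.verts := heq ▸ Set.inter_subset_right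
        refine ⟨C, hC, (hKM.trans (hjoin hM hA hMA)).trans ?_, Reachable.refl _⟩
        exact Adj.reachable ⟨hne, heq.ge, Or.inr hlt⟩
  exact hKL.2 (key p ⟨K, Set.inter_subset_left, Reachable.refl _, Reachable.refl _⟩
    Set.inter_subset_right)

theorem IsChordal.isCliqueTree_greedyCliqueTree [WellFoundedLT ι] (hG : G.IsChordal)
    (hfin : ∀ v : V, (G.neighborSet v).Finite) (hconn : G.Connected)
    {rank : Sym2 G.MaxClique → ι} (hrank : Function.Injective rank) :
    G.IsCliqueTree (greedyCliqueTree rank) := by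
  have hacyc := hG.greedyCliqueTree_isAcyclic hfin hrank
  have hpre := greedyCliqueTree_induce_preconnected hfin rank
  refine ⟨fun _ _ h => h.1, ⟨hconn.of_forall_induce_preconnected hpre, hacyc⟩, fun v => ?_⟩
  obtain ⟨K, hK⟩ := G.exists_maxClique_mem v
  have : Nonempty (G.cliqueFamily v) := ⟨⟨K, hK⟩⟩
  exact ⟨⟨hpre v⟩, hacyc.induce _⟩

theorem exists_injective_rank {α : Type u} (e : α) :
    ∃ (ι : Type u) (_ : LinearOrder ι) (rank : α → ι), WellFoundedLT ι ∧ Function.Injective rank ∧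
      ∀ x, rank e ≤ rank x := by
  classical
  obtain ⟨o, hwf⟩ := exists_wellFoundedLT α
  obtain ⟨m, -, hm⟩ := (wellFounded_lt (α := α)).has_min Set.univ ⟨e, trivial⟩
  refine ⟨α, o, Equiv.swap e m, hwf, (Equiv.swap e m).injective, fun x => ?_⟩
  rw [Equiv.swap_apply_left]
  exact not_lt.1 (hm _ trivial)

/-- Every edge of the reduced clique graph lies in a clique tree. -/
theorem IsChordal.exists_isCliqueTree_adj (hG : G.IsChordal)
    (hfin : ∀ v : V, (G.neighborSet v).Finite) (hconn : G.Connected) {K L : G.MaxClique}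
    (h : G.reducedCliqueGraph.Adj K L) : ∃ T, G.IsCliqueTree T ∧ T.Adj K L := by
  obtain ⟨ι, _, rank, _, hrank, hmin⟩ := exists_injective_rank s(K, L)
  refine ⟨_, hG.isCliqueTree_greedyCliqueTree hfin hconn hrank, h.1, fun hr => ?_⟩
  obtain ⟨a, ha⟩ := MaxClique.exists_mem_diff h.1.1
  obtain ⟨b, hb⟩ := MaxClique.exists_mem_diff h.1.1.symm
  obtain ⟨haS, hbS, hab⟩ := separates_iff.1 (h.2 a ha b hb).1
  refine hab (meetingOutside_reachable (hr.mono fun A B hAB => ?_) ha.1 haS hb.1 hbS)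
  -- Minimal rank rules out ties, so every preceding pair meets outside `K ∩ L`.
  have hne := hAB.2.2.resolve_right (hmin _).not_gt
  obtain ⟨x, hx, hxS⟩ := Set.not_subset.1 fun h => hne (h.antisymm hAB.2.1)
  exact ⟨hAB.1, x, hx.1, hx.2, hxS⟩

end SimpleGraph

theorem mainTheorem6 {V : Type*} (G : SimpleGraph V)
    (hfin : ∀ v : V, (G.neighborSet v).Finite) (hconn : G.Connected) (hchordal : G.IsChordal) :
    (∀ T T' : SimpleGraph G.MaxClique, G.IsCliqueTree T → G.IsCliqueTree T' →
      G.edgeIntersections T = G.edgeIntersections T') ∧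
    (∀ T : SimpleGraph G.MaxClique, G.IsCliqueTree T →
      G.edgeIntersections T = {S : Set V | G.IsMinimalSeparator S}) ∧
    sSup {T : SimpleGraph G.MaxClique | G.IsCliqueTree T} = G.reducedCliqueGraph := by
  refine ⟨fun T T' hT hT' => hT.edgeIntersections_eq.trans hT'.edgeIntersections_eq.symm,
    fun T hT => hT.edgeIntersections_eq, ?_⟩
  refine le_antisymm (sSup_le fun T hT => hT.le_reducedCliqueGraph) fun K L h => ?_
  exact SimpleGraph.sSup_adj.2 (hchordal.exists_isCliqueTree_adj hfin hconn h)
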